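/- Call a set $K\subset\mathbb{R}^3$ a convex body if it is closed, bounded and convex and has nonempty interior. For an affine subspace $P$ of $\mathbb{R}^3$, a closed half-space of $P$ is a set $\{x\in P : \langle a,x\rangle\le c\}$ with $a\neq 0$ a vector parallel to $P$ and $c\in\mathbb{R}$. A (solid, convex) polygon in a plane $P$ is a bounded subset of $P$ that has nonempty interior relative to $P$ and is the intersection of finitely many closed half-planes of $P$; a (solid, convex) polyhedron is a bounded subset of $\mathbb{R}^3$ that has nonempty interior and is the intersection of finitely many closed half-spaces of $\mathbb{R}^3$. **Theorem.** Let $K$ be a convex body in $\mathbb{R}^3$ such that for every plane $P\subset\mathbb{R}^3$ (not necessarily through the origin) the orthogonal projection of $K$ onto $P$ is a polygon in $P$. Then $K$ is a polyhedron. -/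

import Mathlib

open scoped RealInnerProductSpace

namespace KleeProjection

/-- `H` is a closed half-space of the affine subspace `P`: the set of the points `x` of `P` with
`⟪a, x⟫ ≤ c`, for a nonzero normal vector `a` in the direction of `P` and a real number `c`.
For a plane `P` this is a closed half-plane of `P`. -/
def IsClosedHalfspaceIn {E : Type*} [NormedAddCommGroup E] [InnerProductSpace ℝ E]
    (P : AffineSubspace ℝ E) (H : Set E) : Prop :=
  ∃ a ∈ P.direction, a ≠ 0 ∧ ∃ c : ℝ, H = {x | x ∈ P ∧ ⟪a, x⟫ ≤ c}

/-- `X` is polyhedral in the affine subspace `P`: it is the intersection of finitely many closed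
half-spaces of `P` (the intersection of the empty family being `P` itself). -/
def IsPolyhedralIn {E : Type*} [NormedAddCommGroup E] [InnerProductSpace ℝ E]
    (P : AffineSubspace ℝ E) (X : Set E) : Prop :=
  ∃ S : Set (Set E), S.Finite ∧ (∀ H ∈ S, IsClosedHalfspaceIn P H) ∧ X = (P : Set E) ∩ ⋂₀ S

/-- `X` is a convex polytope of full dimension in the affine subspace `P`: it is polyhedral in `P`,
bounded, and has nonempty interior relative to `P`. -/
def IsFullPolytopeIn {E : Type*} [NormedAddCommGroup E] [InnerProductSpace ℝ E]
    (P : AffineSubspace ℝ E) (X : Set E) : Prop :=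
  IsPolyhedralIn P X ∧ Bornology.IsBounded X ∧
    ∃ x ∈ P, ∃ ε > 0, Metric.ball x ε ∩ (P : Set E) ⊆ X

/-- `P` is a (two-dimensional, affine) plane; it need not pass through the origin. -/
def IsPlane {E : Type*} [NormedAddCommGroup E] [InnerProductSpace ℝ E]
    (P : AffineSubspace ℝ E) : Prop :=
  (P : Set E).Nonempty ∧ Module.finrank ℝ P.direction = 2

/-- `X` is a (solid, convex) polygon in the plane `P`. -/
def IsPolygonIn {E : Type*} [NormedAddCommGroup E] [InnerProductSpace ℝ E]
    (P : AffineSubspace ℝ E) (X : Set E) : Prop :=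
  IsPlane P ∧ IsFullPolytopeIn P X

/-- `X` is a (solid, convex) polyhedron in three-dimensional Euclidean space. -/
def IsPolyhedron (X : Set (EuclideanSpace ℝ (Fin 3))) : Prop :=
  IsFullPolytopeIn ⊤ X

/-- A convex body: a closed bounded convex set with nonempty interior. -/
structure IsConvexBody {E : Type*} [NormedAddCommGroup E] [InnerProductSpace ℝ E]
    (K : Set E) : Prop where
  isClosed : IsClosed K
  isBounded : Bornology.IsBounded K
  convex : Convex ℝ K
  nonempty_interior : (interior K).Nonempty

/-- The image of `X` under the orthogonal projection of Euclidean 3-space onto the (nonempty)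
affine subspace `P`, as a set of points of the ambient space. -/
def projectionOnto (P : AffineSubspace ℝ (EuclideanSpace ℝ (Fin 3))) [Nonempty P]
    (X : Set (EuclideanSpace ℝ (Fin 3))) : Set (EuclideanSpace ℝ (Fin 3)) :=
  (fun x => (EuclideanGeometry.orthogonalProjection P x : EuclideanSpace ℝ (Fin 3))) '' X

end KleeProjection

/-!
For a body `K` and a vector `u`, let `F u` be the set of the points of `K` at which `⟪u, ·⟫` is
maximal on `K`. Since a polygon has finitely many extreme points, the hypothesis on the projection
of `K` onto the plane spanned by two orthogonal vectors `u` and `v` yields a point common to `F u`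
and `F (u + ε • v)` for some `ε > 0` (`exists_common_maximizer`); in other words, the support
function of `K` is linear on a short segment leaving `u` in any given direction.

Two applications of this fact give linearity on three-dimensional simplicial cones. If `F u` and
`F (u + ε • v)` meet, then `F (2 • u + ε • v)` is contained in both. For `w` orthogonal to `u` and
`v`, a point that `F (2 • u + ε • v)` shares with `F (2 • u + ε • v + δ • w)` thus maximizes every
functional in the cone spanned by `u`, `u + ε • v` and `2 • u + ε • v + δ • w`
(`exists_maximizer_on_sector`). The two cones for `w` and `-w` together contain all functionals
`u + t • v'` with `t ≥ 0` small and `v'` a unit vector orthogonal to `u` and close to `v`.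
Compactness of the unit circle orthogonal to `u`, and then of the unit sphere, produces a finite set
`T` such that every linear functional attains its maximum over `K` at a point of `T ∩ K`
(`exists_finite_maximizers`).

It follows that, for an interior point `p`, the polar set of `K - p` is cut out by the finitely many
inequalities `⟪y, t - p⟫ ≤ 1` with `t ∈ T ∩ K`. It is bounded, so it is the convex hull of its
finitely many extreme points, and by the separation theorem these describe `K` by finitely many
half-spaces (`isPolyhedralIn_top_of_finite_maximizers`).
-/

namespace KleeProjection

open Filter Topology

section General

variable {E : Type*} [NormedAddCommGroup E] [InnerProductSpace ℝ E]

/-! ### Maximizers of linear functionals -/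

/-- The set of the points of `K` at which the functional `⟪u, ·⟫` attains its maximum over `K`:
the face of `K` with outer normal `u` (all of `K` if `u = 0`). -/
def maximizers (K : Set E) (u : E) : Set E := {x | x ∈ K ∧ ∀ k ∈ K, ⟪u, k⟫ ≤ ⟪u, x⟫}

lemma maximizers_zero (K : Set E) : maximizers K 0 = K := by
  ext x
  simp [maximizers]

lemma mem_maximizers_add {K : Set E} {a b x : E} (ha : x ∈ maximizers K a)
    (hb : x ∈ maximizers K b) : x ∈ maximizers K (a + b) := by
  refine ⟨ha.1, fun k hk => ?_⟩
  rw [inner_add_left, inner_add_left]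
  exact add_le_add (ha.2 k hk) (hb.2 k hk)

lemma mem_maximizers_smul {K : Set E} {a x : E} (ha : x ∈ maximizers K a) {s : ℝ} (hs : 0 ≤ s) :
    x ∈ maximizers K (s • a) := by
  refine ⟨ha.1, fun k hk => ?_⟩
  rw [real_inner_smul_left, real_inner_smul_left]
  exact mul_le_mul_of_nonneg_left (ha.2 k hk) hs

/-- If the faces with normals `a` and `b` meet, then the face with normal `a + b` is contained in
their intersection. -/
lemma mem_maximizers_of_mem_add {K : Set E} {a b x y : E} (ha : x ∈ maximizers K a)
    (hb : x ∈ maximizers K b) (hy : y ∈ maximizers K (a + b)) :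
    y ∈ maximizers K a ∧ y ∈ maximizers K b := by
  have h := hy.2 x ha.1
  rw [inner_add_left, inner_add_left] at h
  have h1 := ha.2 y hy.1
  have h2 := hb.2 y hy.1
  exact ⟨⟨hy.1, fun k hk => by linarith [ha.2 k hk]⟩, ⟨hy.1, fun k hk => by linarith [hb.2 k hk]⟩⟩

lemma maximizers_nonempty {K : Set E} (hK : IsCompact K) (hne : K.Nonempty) (u : E) :
    (maximizers K u).Nonempty := by
  obtain ⟨x, hx, hmax⟩ := hK.exists_isMaxOn hne (f := fun y => ⟪u, y⟫) (by fun_prop)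
  exact ⟨x, hx, fun k hk => hmax hk⟩

/-! ### Extreme points of polyhedral sets -/

/-- On a compact set a linear functional attains its maximum at an extreme point. -/
lemma exists_extremePoint_mem_maximizers {Q : Set E} (hQ : IsCompact Q) (hne : Q.Nonempty) (u : E) :
    ∃ e ∈ Q.extremePoints ℝ, e ∈ maximizers Q u := by
  have hexp : IsExposed ℝ Q (maximizers Q u) := fun _ => ⟨innerSL ℝ u, by simp [maximizers]⟩
  obtain ⟨e, he⟩ := (hexp.isCompact hQ).extremePoints_nonempty (maximizers_nonempty hQ hne u)
  exact ⟨e, hexp.isExtreme.extremePoints_subset_extremePoints he, he.1⟩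

/-- A set defined in an affine subspace by finitely many linear inequalities has finitely many
extreme points: an extreme point is determined by the inequalities that are equalities there. -/
lemma finite_extremePoints_of_inequalities {ι : Type*} [Finite ι] (P : AffineSubspace ℝ E)
    (a : ι → E) (c : ι → ℝ) :
    (Set.extremePoints ℝ {x | x ∈ P ∧ ∀ i, ⟪a i, x⟫ ≤ c i}).Finite := by
  refine Set.Finite.of_injOn (f := fun x => {i | ⟪a i, x⟫ = c i}) (t := Set.univ)
    (fun _ _ => Set.mem_univ _) ?_ Set.finite_univ
  intro x hx y hy hxy
  -- Beyond `x`, the line from `y` to `x` stays in the set for a while.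
  have hev : ∀ᶠ s : ℝ in 𝓝[>] 0, ∀ i, ⟪a i, x + s • (x - y)⟫ ≤ c i := by
    rw [eventually_all]
    intro i
    rcases (hx.1.2 i).lt_or_eq with h | h
    · have hcont : ContinuousAt (fun s : ℝ => ⟪a i, x + s • (x - y)⟫) 0 := by fun_prop
      have : ∀ᶠ s : ℝ in 𝓝 0, ⟪a i, x + s • (x - y)⟫ < c i :=
        hcont.eventually_lt continuousAt_const (by simpa using h)
      filter_upwards [nhdsWithin_le_nhds this] with s hs using hs.le
    · have hy' : ⟪a i, y⟫ = c i := by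
        have : i ∈ {i | ⟪a i, y⟫ = c i} := by rw [← show _ = {i | ⟪a i, y⟫ = c i} from hxy]; exact h
        exact this
      refine Eventually.of_forall fun s => ?_
      rw [inner_add_right, real_inner_smul_right, inner_sub_right, h, hy']
      simp
  obtain ⟨s, hs, hs0⟩ := (hev.and self_mem_nhdsWithin).exists
  have hs0 : (0 : ℝ) < s := hs0
  have hz : x + s • (x - y) ∈ P := by
    have := AffineMap.lineMap_mem (-s) hx.1.1 hy.1.1
    rw [AffineMap.lineMap_apply_module'] at this
    convert this using 1
    module
  have hseg : x ∈ openSegment ℝ y (x + s • (x - y)) := by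
    refine ⟨s / (1 + s), 1 / (1 + s), by positivity, by positivity, by field_simp; ring, ?_⟩
    have h1 : s / (1 + s) = 1 - 1 / (1 + s) := by field_simp; ring
    have h2 : 1 / (1 + s) * s = 1 - 1 / (1 + s) := by field_simp; ring
    rw [smul_add, smul_smul, h2, h1]
    module
  exact (hx.2 hy.1 ⟨hz, hs⟩ hseg).symm

lemma IsPolyhedralIn.finite_extremePoints {P : AffineSubspace ℝ E} {X : Set E}
    (hX : IsPolyhedralIn P X) : (X.extremePoints ℝ).Finite := by
  obtain ⟨S, hS, hH, rfl⟩ := hX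
  choose! a _ _ c hc using hH
  have := hS.to_subtype
  convert finite_extremePoints_of_inequalities P (fun H : S => a H) (fun H : S => c H) using 2
  ext x
  simp only [Set.mem_inter_iff, SetLike.mem_coe, Set.mem_sInter, Set.mem_ofPred_eq]
  refine and_congr_right fun hx => ⟨fun h i => ?_, fun h H hHS => ?_⟩
  · have := h i i.2
    rw [hc i i.2] at this
    exact this.2
  · rw [hc H hHS]
    exact ⟨hx, h ⟨H, hHS⟩⟩

/-! ### From finitely many maximizers to finitely many half-spaces -/

/-- If every linear functional attains its maximum over the convex body `K` at a point of
a fixed finite set `T`, then `K` is an intersection of finitely many half-spaces. Their normals are the extreme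
points of the polar set of `K - p`, where `p` is an interior point of `K`. -/
lemma isPolyhedralIn_top_of_finite_maximizers [FiniteDimensional ℝ E] {K : Set E}
    (hK : IsConvexBody K) {T : Set E} (hT : T.Finite) (hTK : ∀ u, ∃ x ∈ T, x ∈ maximizers K u) :
    IsPolyhedralIn ⊤ K := by
  obtain ⟨p, hp⟩ := hK.nonempty_interior
  have hpK : p ∈ K := interior_subset hp
  obtain ⟨r, hr, hball⟩ := Metric.isOpen_iff.1 isOpen_interior p hp
  obtain ⟨Y, hY⟩ : ∃ Y : Set E, Y = {y | ∀ k ∈ K, ⟪y, k - p⟫ ≤ 1} := ⟨_, rfl⟩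
  have hTY : Y = {y | y ∈ (⊤ : AffineSubspace ℝ E) ∧
      ∀ t : ↥(T ∩ K), ⟪(t : E) - p, y⟫ ≤ (1 : ℝ)} := by
    rw [hY]
    ext y
    simp only [Set.mem_ofPred_eq, AffineSubspace.mem_top, true_and]
    refine ⟨fun h t => by rw [real_inner_comm]; exact h t t.2.2, fun h k hk => ?_⟩
    obtain ⟨x, hxT, hx⟩ := hTK y
    have h1 := h ⟨x, hxT, hx.1⟩
    have h2 := hx.2 k hk
    rw [real_inner_comm, inner_sub_right] at h1
    rw [inner_sub_right]
    linarith
  have hext : (Y.extremePoints ℝ).Finite := by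
    have := (hT.inter_of_left K).to_subtype
    rw [hTY]
    exact finite_extremePoints_of_inequalities _ _ _
  have hYc : IsCompact Y := by
    refine Metric.isCompact_of_isClosed_isBounded ?_ ?_
    · rw [hY, Set.ofPred_forall]
      refine isClosed_iInter fun k => ?_
      rw [Set.ofPred_forall]
      exact isClosed_iInter fun _ => isClosed_le (by fun_prop) continuous_const
    · -- Testing `y` against the point of `K` at distance `r / 2` from `p` in direction `y`.
      refine (Metric.isBounded_closedBall (x := (0 : E)) (r := 2 / r)).subset fun y hy => ?_
      rw [mem_closedBall_zero_iff]
      by_cases hy0 : y = 0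
      · rw [hy0, norm_zero]; positivity
      have hn : 0 < ‖y‖ := norm_pos_iff.2 hy0
      rw [hY] at hy
      have hk : p + (r / 2 / ‖y‖) • y ∈ K := by
        refine interior_subset (hball ?_)
        rw [Metric.mem_ball, dist_eq_norm, add_sub_cancel_left, norm_smul, Real.norm_eq_abs,
          abs_of_pos (by positivity), div_mul_cancel₀ _ hn.ne']
        linarith
      have := hy _ hk
      rw [add_sub_cancel_left, real_inner_smul_right, real_inner_self_eq_norm_sq] at this
      rw [le_div_iff₀ hr]
      have h3 : r / 2 / ‖y‖ * ‖y‖ ^ 2 = r / 2 * ‖y‖ := by field_simp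
      linarith
  refine ⟨(fun e => {x | x ∈ (⊤ : AffineSubspace ℝ E) ∧ ⟪e, x⟫ ≤ 1 + ⟪e, p⟫}) ''
    (Y.extremePoints ℝ \ {0}), (hext.subset Set.sdiff_subset).image _, ?_, ?_⟩
  · rintro _ ⟨e, he, rfl⟩
    exact ⟨e, by simp, he.2, 1 + ⟪e, p⟫, rfl⟩
  · refine Set.Subset.antisymm (fun x hx => ⟨trivial, ?_⟩) fun x hx => ?_
    · rintro _ ⟨e, he, rfl⟩
      have h := he.1.1
      rw [hY] at h
      have := h x hx
      rw [inner_sub_right] at this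
      exact ⟨trivial, by linarith⟩
    · by_contra hxK
      obtain ⟨f, c, hf, hfx⟩ := geometric_hahn_banach_closed_point hK.convex hK.isClosed hxK
      obtain ⟨y, rfl⟩ := (InnerProductSpace.toDual ℝ E).surjective f
      simp only [InnerProductSpace.toDual_apply_apply] at hf hfx
      have hd : 0 < c - ⟪y, p⟫ := sub_pos.2 (hf p hpK)
      -- The separating functional, scaled into the polar set.
      have hyY : (c - ⟪y, p⟫)⁻¹ • y ∈ Y := by
        rw [hY]
        intro k hk
        rw [real_inner_smul_left, inner_sub_right, inv_mul_le_iff₀ hd]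
        linarith [hf k hk]
      obtain ⟨e, he, hmax⟩ := exists_extremePoint_mem_maximizers hYc ⟨_, hyY⟩ (x - p)
      have h1 := hmax.2 _ hyY
      have h2 : 1 < ⟪x - p, (c - ⟪y, p⟫)⁻¹ • y⟫ := by
        rw [real_inner_smul_right, real_inner_comm y (x - p), inner_sub_right,
          lt_inv_mul_iff₀ hd]
        linarith
      have h3 : 1 < ⟪e, x⟫ - ⟪e, p⟫ := by
        rw [← inner_sub_right, real_inner_comm]
        exact h2.trans_le h1
      have he0 : e ≠ 0 := by
        rintro rfl
        simp only [inner_zero_left] at h3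
        linarith
      have := (hx.2 _ ⟨e, ⟨he, he0⟩, rfl⟩).2
      linarith

/-! ### Finitely many maximizers from linearity along segments -/

/-- If the support function of `K` is linear on a short segment leaving any vector in any
orthogonal direction, then one point of `K` maximizes all functionals `u + t • v'` with `t` small
and `v'` in a sector bounded by the ray through `v` and lying on the side of `w`. -/
lemma exists_maximizer_on_sector {K : Set E}
    (hseg : ∀ u v : E, u ≠ 0 → v ≠ 0 → ⟪u, v⟫ = 0 →
      ∃ ε > 0, ∃ x, x ∈ maximizers K u ∧ x ∈ maximizers K (u + (ε : ℝ) • v))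
    {u v w : E} (hu : u ≠ 0) (hv : v ≠ 0) (hw : w ≠ 0) (huv : ⟪u, v⟫ = 0) (huw : ⟪u, w⟫ = 0)
    (hvw : ⟪v, w⟫ = 0) :
    ∃ x, ∃ ε > 0, ∃ δ > 0, ∀ t α β : ℝ, 0 ≤ t → t * α ≤ ε → 0 ≤ β → β ≤ δ * α →
      x ∈ maximizers K (u + t • (α • v + β • w)) := by
  obtain ⟨ε, hε, x, hx1, hx2⟩ := hseg u v hu hv huv
  have hm0 : u + (u + ε • v) ≠ 0 := by
    intro h
    have : ⟪u, u + (u + ε • v)⟫ = 0 := by rw [h, inner_zero_right]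
    rw [inner_add_right, inner_add_right, real_inner_smul_right, huv] at this
    have h0 : ⟪u, u⟫ = 0 := by linarith
    exact hu (inner_self_eq_zero.1 h0)
  have hmw : ⟪u + (u + ε • v), w⟫ = 0 := by
    rw [inner_add_left, inner_add_left, real_inner_smul_left, huw, hvw]
    simp
  obtain ⟨δ, hδ, y, hy1, hy2⟩ := hseg _ w hm0 hw hmw
  obtain ⟨hy3, hy4⟩ := mem_maximizers_of_mem_add hx1 hx2 hy1
  refine ⟨y, ε / 2, by positivity, δ / ε, by positivity, fun t α β ht htα hβ hβα => ?_⟩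
  -- The coordinates of the functional in the cone of `u`, `u + ε v` and `2 u + ε v + δ w`.
  have hr : 0 ≤ t * β / δ := by positivity
  have hrq : t * β / δ ≤ t * α / ε := by
    rw [div_le_div_iff₀ hδ hε]
    have : β * ε ≤ δ * α := by
      have := mul_le_mul_of_nonneg_right hβα hε.le
      have h' : δ / ε * α * ε = δ * α := by field_simp
      linarith
    nlinarith
  have hhalf : t * α / ε ≤ 1 / 2 := by
    rw [div_le_iff₀ hε]
    linarith
  have key := mem_maximizers_add (mem_maximizers_add
    (mem_maximizers_smul hy3 (s := 1 - t * α / ε - t * β / δ) (by linarith))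
    (mem_maximizers_smul hy4 (s := t * α / ε - t * β / δ) (by linarith)))
    (mem_maximizers_smul hy2 hr)
  convert key using 2
  have h1 : t * α = (t * α / ε) * ε := by field_simp
  have h2 : t * β = (t * β / δ) * δ := by field_simp
  rw [smul_add, smul_smul, smul_smul, h1, h2]
  generalize t * α / ε = p
  generalize t * β / δ = q
  have h3 : p * ε / ε = p := by field_simp
  have h4 : q * δ / δ = q := by field_simp
  rw [h3, h4]
  module

/-- In a three-dimensional space, two orthonormal vectors have a common unit normal. -/
lemma exists_unit_normal (hE : Module.finrank ℝ E = 3) {u v : E} (hu : ‖u‖ = 1) (hv : ‖v‖ = 1)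
    (huv : ⟪u, v⟫ = 0) :
    ∃ w : E, ‖w‖ = 1 ∧ ⟪u, w⟫ = 0 ∧ ⟪v, w⟫ = 0 ∧
      ∀ z, ⟪u, z⟫ = 0 → z = ⟪v, z⟫ • v + ⟪w, z⟫ • w := by
  have : FiniteDimensional ℝ E := Module.finite_of_finrank_eq_succ hE
  have ho : Orthonormal ℝ (({0, 1} : Set (Fin 3)).domRestrict ![u, v, 0]) := by
    rw [orthonormal_iff_ite]
    rintro ⟨i, hi⟩ ⟨j, hj⟩
    simp only [Set.mem_insert_iff, Set.mem_singleton_iff] at hi hj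
    rcases hi with rfl | rfl <;> rcases hj with rfl | rfl <;>
      simp [Set.domRestrict_apply, hu, hv, huv, real_inner_comm u v]
  obtain ⟨b, hb⟩ := ho.exists_orthonormalBasis_extension_of_card_eq (by simpa using hE)
  have h0 : b 0 = u := by simpa using hb 0 (by simp)
  have h1 : b 1 = v := by simpa using hb 1 (by simp)
  refine ⟨b 2, b.norm_eq_one 2, ?_, ?_, fun z hz => ?_⟩
  · rw [← h0]; exact b.inner_eq_zero (by decide)
  · rw [← h1]; exact b.inner_eq_zero (by decide)
  · have := b.sum_repr' z
    rw [Fin.sum_univ_three, h0, h1, hz, zero_smul, zero_add] at this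
    exact this.symm

/-- In dimension three, if the support function of `K` is linear on a short segment leaving any
vector in any orthogonal direction, then finitely many points suffice to maximize all functionals
near a given one. -/
lemma exists_finite_maximizers_nhds (hE : Module.finrank ℝ E = 3) {K : Set E} (hK : IsCompact K)
    (hne : K.Nonempty)
    (hseg : ∀ u v : E, u ≠ 0 → v ≠ 0 → ⟪u, v⟫ = 0 →
      ∃ ε > 0, ∃ x, x ∈ maximizers K u ∧ x ∈ maximizers K (u + (ε : ℝ) • v))
    {u : E} (hu : ‖u‖ = 1) :
    ∃ T : Set E, T.Finite ∧ ∀ᶠ y in 𝓝 u, ∃ x ∈ T, x ∈ maximizers K y := by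
  have : FiniteDimensional ℝ E := Module.finite_of_finrank_eq_succ hE
  have hu0 : u ≠ 0 := norm_ne_zero_iff.1 (by rw [hu]; exact one_ne_zero)
  -- The circle of unit vectors orthogonal to `u`.
  have hC : IsCompact (Metric.sphere (0 : E) 1 ∩ {v | ⟪u, v⟫ = 0}) :=
    (isCompact_sphere 0 1).inter_right (isClosed_eq (by fun_prop) continuous_const)
  have hcirc : ∃ T : Set E, T.Finite ∧ ∃ η > 0, ∀ v ∈ Metric.sphere (0 : E) 1 ∩ {v | ⟪u, v⟫ = 0},
      ∀ t : ℝ, 0 ≤ t → t ≤ η → ∃ x ∈ T, x ∈ maximizers K (u + t • v) := by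
    refine hC.induction_on (p := fun s => ∃ T : Set E, T.Finite ∧ ∃ η > 0, ∀ v ∈ s,
      ∀ t : ℝ, 0 ≤ t → t ≤ η → ∃ x ∈ T, x ∈ maximizers K (u + t • v)) ?_ ?_ ?_ ?_
    · exact ⟨∅, Set.finite_empty, 1, one_pos, by simp⟩
    · rintro s s' hss ⟨T, hT, η, hη, h⟩
      exact ⟨T, hT, η, hη, fun v hv => h v (hss hv)⟩
    · rintro s s' ⟨T, hT, η, hη, h⟩ ⟨T', hT', η', hη', h'⟩
      refine ⟨T ∪ T', hT.union hT', min η η', lt_min hη hη', ?_⟩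
      rintro v (hv | hv) t ht htη
      · obtain ⟨x, hx, hm⟩ := h v hv t ht (htη.trans (min_le_left _ _))
        exact ⟨x, Or.inl hx, hm⟩
      · obtain ⟨x, hx, hm⟩ := h' v hv t ht (htη.trans (min_le_right _ _))
        exact ⟨x, Or.inr hx, hm⟩
    · rintro v ⟨hv, huv⟩
      rw [mem_sphere_zero_iff_norm] at hv
      have hv0 : v ≠ 0 := norm_ne_zero_iff.1 (by rw [hv]; exact one_ne_zero)
      obtain ⟨w, hw, huw, hvw, hrep⟩ := exists_unit_normal hE hu hv huv
      have hw0 : w ≠ 0 := norm_ne_zero_iff.1 (by rw [hw]; exact one_ne_zero)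
      obtain ⟨x, ε, hε, δ, hδ, hx⟩ := exists_maximizer_on_sector hseg hu0 hv0 hw0 huv huw hvw
      obtain ⟨x', ε', hε', δ', hδ', hx'⟩ := exists_maximizer_on_sector hseg hu0 hv0
        (neg_ne_zero.2 hw0) huv (by rw [inner_neg_right, huw, neg_zero])
        (by rw [inner_neg_right, hvw, neg_zero])
      have hnhds : ∀ᶠ z in 𝓝 v, ⟪w, z⟫ < δ * ⟪v, z⟫ ∧ -⟪w, z⟫ < δ' * ⟪v, z⟫ := by
        have hwv : ⟪w, v⟫ = 0 := by rw [real_inner_comm, hvw]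
        refine (ContinuousAt.eventually_lt (by fun_prop) (by fun_prop) ?_).and
          (ContinuousAt.eventually_lt (by fun_prop) (by fun_prop) ?_)
        · simpa [hv, hwv] using hδ
        · simpa [hv, hwv] using hδ'
      refine ⟨_, inter_mem_nhdsWithin _ hnhds, {x, x'}, by simp, min ε ε', lt_min hε hε', ?_⟩
      rintro z ⟨⟨hz, huz⟩, hz1, hz2⟩ t ht htη
      rw [mem_sphere_zero_iff_norm] at hz
      have hvz : ⟪v, z⟫ ≤ 1 := by
        have := real_inner_le_norm v z
        rwa [hv, hz, one_mul] at this
      have htv : t * ⟪v, z⟫ ≤ min ε ε' := (mul_le_of_le_one_right ht hvz).trans htη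
      rw [hrep z huz]
      rcases le_total 0 ⟪w, z⟫ with h | h
      · exact ⟨x, by simp, hx t _ _ ht (htv.trans (min_le_left _ _)) h hz1.le⟩
      · refine ⟨x', by simp, ?_⟩
        have := hx' t _ _ ht (htv.trans (min_le_right _ _)) (neg_nonneg.2 h) hz2.le
        rwa [neg_smul_neg] at this
  obtain ⟨T, hT, η, hη, hTm⟩ := hcirc
  obtain ⟨x₀, hx₀⟩ := maximizers_nonempty hK hne u
  refine ⟨insert x₀ T, hT.insert _, ?_⟩
  have huu : ⟪u, u⟫ = 1 := by rw [real_inner_self_eq_norm_sq, hu, one_pow]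
  have h1 : ∀ᶠ y in 𝓝 u, ‖y - ⟪u, y⟫ • u‖ < η * ⟪u, y⟫ :=
    ContinuousAt.eventually_lt (by fun_prop) (by fun_prop) (by simpa [hu] using hη)
  filter_upwards [h1] with y hy
  have hs : 0 < ⟪u, y⟫ := by
    have := (norm_nonneg _).trans_lt hy
    exact pos_of_mul_pos_right this hη.le
  obtain ⟨z, hz⟩ : ∃ z, z = y - ⟪u, y⟫ • u := ⟨_, rfl⟩
  have hyz : y = ⟪u, y⟫ • u + z := by rw [hz]; abel
  have huz : ⟪u, z⟫ = 0 := by rw [hz, inner_sub_right, real_inner_smul_right, huu, mul_one, sub_self]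
  rw [← hz] at hy
  rcases eq_or_ne z 0 with hz0 | hz0
  · refine ⟨x₀, by simp, ?_⟩
    rw [hyz, hz0, add_zero]
    exact mem_maximizers_smul hx₀ hs.le
  · have hzn : 0 < ‖z‖ := norm_pos_iff.2 hz0
    obtain ⟨x, hxT, hx⟩ := hTm (‖z‖⁻¹ • z) ⟨by
        rw [mem_sphere_zero_iff_norm, norm_smul, norm_inv, norm_norm, inv_mul_cancel₀ hzn.ne'],
        by simp [real_inner_smul_right, huz]⟩ (‖z‖ / ⟪u, y⟫) (by positivity)
        ((div_le_iff₀ hs).2 hy.le)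
    refine ⟨x, Or.inr hxT, ?_⟩
    have := mem_maximizers_smul hx hs.le
    have hcoef : ⟪u, y⟫ * (‖z‖ / ⟪u, y⟫ * ‖z‖⁻¹) = 1 := by field_simp
    rw [smul_add, smul_smul, smul_smul, mul_assoc, hcoef, one_smul, ← hyz] at this
    exact this

/-- In dimension three, if the support function of `K` is linear on a short segment leaving any
vector in any orthogonal direction, then there is a finite set on which every functional attains its
maximum over `K`. -/
lemma exists_finite_maximizers (hE : Module.finrank ℝ E = 3) {K : Set E} (hK : IsCompact K)
    (hne : K.Nonempty)
    (hseg : ∀ u v : E, u ≠ 0 → v ≠ 0 → ⟪u, v⟫ = 0 →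
      ∃ ε > 0, ∃ x, x ∈ maximizers K u ∧ x ∈ maximizers K (u + (ε : ℝ) • v)) :
    ∃ T : Set E, T.Finite ∧ ∀ u, ∃ x ∈ T, x ∈ maximizers K u := by
  have : FiniteDimensional ℝ E := Module.finite_of_finrank_eq_succ hE
  have hsph : ∃ T : Set E, T.Finite ∧ ∀ y ∈ Metric.sphere (0 : E) 1,
      ∃ x ∈ T, x ∈ maximizers K y := by
    refine (isCompact_sphere (0 : E) 1).induction_on (p := fun s => ∃ T : Set E, T.Finite ∧
      ∀ y ∈ s, ∃ x ∈ T, x ∈ maximizers K y) ⟨∅, Set.finite_empty, by simp⟩ ?_ ?_ ?_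
    · rintro s s' hss ⟨T, hT, h⟩
      exact ⟨T, hT, fun v hv => h v (hss hv)⟩
    · rintro s s' ⟨T, hT, h⟩ ⟨T', hT', h'⟩
      refine ⟨T ∪ T', hT.union hT', ?_⟩
      rintro v (hv | hv)
      · obtain ⟨x, hx, hm⟩ := h v hv
        exact ⟨x, Or.inl hx, hm⟩
      · obtain ⟨x, hx, hm⟩ := h' v hv
        exact ⟨x, Or.inr hx, hm⟩
    · intro u hu
      rw [mem_sphere_zero_iff_norm] at hu
      obtain ⟨T, hT, h⟩ := exists_finite_maximizers_nhds hE hK hne hseg hu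
      exact ⟨_, mem_nhdsWithin_of_mem_nhds h, T, hT, fun y hy => hy⟩
  obtain ⟨T, hT, h⟩ := hsph
  obtain ⟨k, hk⟩ := hne
  refine ⟨insert k T, hT.insert _, fun u => ?_⟩
  rcases eq_or_ne u 0 with rfl | hu
  · exact ⟨k, by simp, by rwa [maximizers_zero]⟩
  · have hn : 0 < ‖u‖ := norm_pos_iff.2 hu
    obtain ⟨x, hxT, hx⟩ := h (‖u‖⁻¹ • u) (by
      rw [mem_sphere_zero_iff_norm, norm_smul, norm_inv, norm_norm, inv_mul_cancel₀ hn.ne'])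
    refine ⟨x, Or.inr hxT, ?_⟩
    have := mem_maximizers_smul hx hn.le
    rwa [smul_smul, mul_inv_cancel₀ hn.ne', one_smul] at this

end General

/-! ### Linearity along segments from polygonal projections -/

/-- If the projections of `K` onto planes are polygons, then the support function of `K` is linear
on a short segment leaving `u` in direction `v`: as `t` decreases to `0`, one of the finitely many
extreme points of the projection onto the plane spanned by `u` and `v` maximizes `u + t • v` for
arbitrarily small `t`, and hence also maximizes `u`. -/
lemma exists_common_maximizer {K : Set (EuclideanSpace ℝ (Fin 3))} (hK : IsCompact K)
    (hne : K.Nonempty)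
    (hproj : ∀ (P : AffineSubspace ℝ (EuclideanSpace ℝ (Fin 3))) [Nonempty P],
      IsPlane P → IsPolygonIn P (projectionOnto P K))
    (u v : EuclideanSpace ℝ (Fin 3)) (hu : u ≠ 0) (hv : v ≠ 0) (huv : ⟪u, v⟫ = 0) :
    ∃ ε > 0, ∃ x, x ∈ maximizers K u ∧ x ∈ maximizers K (u + (ε : ℝ) • v) := by
  obtain ⟨V, hV⟩ : ∃ V, V = Submodule.span ℝ (Set.range ![u, v]) := ⟨_, rfl⟩
  have huV : u ∈ V := hV ▸ Submodule.subset_span ⟨0, rfl⟩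
  have hvV : v ∈ V := hV ▸ Submodule.subset_span ⟨1, rfl⟩
  have hrank : Module.finrank ℝ V = 2 := by
    have hli : LinearIndependent ℝ ![u, v] := by
      refine linearIndependent_of_ne_zero_of_inner_eq_zero (𝕜 := ℝ) ?_ ?_
      · intro i
        fin_cases i
        · exact hu
        · exact hv
      · intro i j hij
        fin_cases i <;> fin_cases j <;> simp_all [real_inner_comm]
    rw [hV, finrank_span_eq_card hli, Fintype.card_fin]
  have : Nonempty V.toAffineSubspace := ⟨⟨0, V.zero_mem⟩⟩
  have hpoly := (hproj V.toAffineSubspace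
    ⟨⟨0, V.zero_mem⟩, by rw [Submodule.toAffineSubspace_direction]; exact hrank⟩).2
  obtain ⟨π, hπ⟩ : ∃ π : EuclideanSpace ℝ (Fin 3) → EuclideanSpace ℝ (Fin 3), π = fun x =>
    (EuclideanGeometry.orthogonalProjection V.toAffineSubspace x : EuclideanSpace ℝ (Fin 3)) :=
    ⟨_, rfl⟩
  have hQ : projectionOnto V.toAffineSubspace K = π '' K := by rw [hπ]; rfl
  rw [hQ] at hpoly
  have hπc : Continuous π := by
    rw [hπ]
    exact continuous_subtype_val.comp
      (EuclideanGeometry.orthogonalProjection V.toAffineSubspace).continuous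
  have hinner : ∀ f ∈ V, ∀ k, ⟪f, π k⟫ = ⟪f, k⟫ := by
    intro f hf k
    have h := EuclideanGeometry.vsub_orthogonalProjection_mem_direction_orthogonal
      V.toAffineSubspace k
    have h2 := (Submodule.mem_orthogonal _ _).1 h f
      (by rwa [Submodule.toAffineSubspace_direction])
    rw [vsub_eq_sub, inner_sub_right] at h2
    rw [hπ]
    linarith
  have hfin := hpoly.1.finite_extremePoints
  have hmaxt : ∀ t : ℝ, ∃ e ∈ (π '' K).extremePoints ℝ, e ∈ maximizers (π '' K) (u + t • v) :=
    fun t => exists_extremePoint_mem_maximizers (hK.image hπc) (hne.image π) _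
  obtain ⟨e, -, hfreq⟩ : ∃ e ∈ (π '' K).extremePoints ℝ,
      ∃ᶠ t : ℝ in 𝓝[>] 0, e ∈ maximizers (π '' K) (u + t • v) := by
    by_contra! hcon
    obtain ⟨t, ht⟩ := ((eventually_all_finite hfin).2 hcon).exists
    obtain ⟨e, he, hm⟩ := hmaxt t
    exact ht e he hm
  have hclosed : IsClosed {t : ℝ | ∀ k ∈ π '' K, ⟪u + t • v, k⟫ ≤ ⟪u + t • v, e⟫} := by
    rw [Set.ofPred_forall]
    refine isClosed_iInter fun k => ?_
    rw [Set.ofPred_forall]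
    exact isClosed_iInter fun _ => isClosed_le (by fun_prop) (by fun_prop)
  have h0 : ∀ k ∈ π '' K, ⟪u + (0 : ℝ) • v, k⟫ ≤ ⟪u + (0 : ℝ) • v, e⟫ :=
    hclosed.mem_of_frequently_of_tendsto (hfreq.mono fun t ht => ht.2)
      (tendsto_id.mono_left nhdsWithin_le_nhds)
  obtain ⟨ε, hε, hε0⟩ := (hfreq.and_eventually self_mem_nhdsWithin).exists
  obtain ⟨x, hx, rfl⟩ := hε.1
  refine ⟨ε, hε0, x, ⟨hx, fun k hk => ?_⟩, ⟨hx, fun k hk => ?_⟩⟩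
  · have := h0 _ ⟨k, hk, rfl⟩
    rwa [zero_smul, add_zero, hinner u huV, hinner u huV] at this
  · have := hε.2 _ ⟨k, hk, rfl⟩
    have hm : u + ε • v ∈ V := V.add_mem huV (V.smul_mem ε hvV)
    rwa [hinner _ hm, hinner _ hm] at this

end KleeProjection

theorem mainTheorem1 (K : Set (EuclideanSpace ℝ (Fin 3)))
    (hK : KleeProjection.IsConvexBody K)
    (hproj : ∀ (P : AffineSubspace ℝ (EuclideanSpace ℝ (Fin 3))) [Nonempty P],
      KleeProjection.IsPlane P →
        KleeProjection.IsPolygonIn P (KleeProjection.projectionOnto P K)) :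
    KleeProjection.IsPolyhedron K := by
  have hc : IsCompact K := Metric.isCompact_of_isClosed_isBounded hK.isClosed hK.isBounded
  have hne : K.Nonempty := hK.nonempty_interior.mono interior_subset
  obtain ⟨T, hT, hTK⟩ := KleeProjection.exists_finite_maximizers (by simp) hc hne
    (KleeProjection.exists_common_maximizer hc hne hproj)
  refine ⟨KleeProjection.isPolyhedralIn_top_of_finite_maximizers hK hT hTK, hK.isBounded, ?_⟩
  obtain ⟨p, hp⟩ := hK.nonempty_interior
  obtain ⟨r, hr, hball⟩ := Metric.isOpen_iff.1 isOpen_interior p hp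
  exact ⟨p, trivial, r, hr, fun x hx => interior_subset (hball hx.1)⟩
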